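/- Let $E$ be a complete separable metric (that is, Polish) real topological vector space and let $\mathcal P(E)$ be the set of Borel probability measures on $E$ with the weak topology. Write $\mu\nu$ for the convolution of $\mu,\nu\in\mathcal P(E)$, and $T(\mu)(B)=\mu(T^{-1}(B))$ for an invertible continuous linear operator $T$ on $E$. Let $(T_t)_{t>0}$ be a one-parameter group of invertible continuous linear operators on $E$, i.e. $T_{st}=T_sT_t$ for $s,t>0$ and $t\mapsto T_t x$ is continuous on $(0,\infty)$ for every $x\in E$, such that $T_t x\to 0$ as $t\to 0$ for every $x\in E$, and let $0<b<1$. A subset $H\subset\mathcal P(E)$ is called $(T_t)$-completely closed if it is closed, $\mu\nu\in H$ whenever $\mu,\nu\in H$, and $T_a(\mu)\,\delta_x\in H$ whenever $\mu\in H$, $a>0$, $x\in E$. For $H\subset\mathcal P(E)$ let $\tilde K(H,b,(T_t))$ be the set of all $\mu\in\mathcal P(E)$ for which there are a sequence $(\mu_n)$ in $H$, positive reals $(a_n)$, positive integers $k_1<k_2<\cdots$ and a sequence $(x_n)$ in $E$ with $$\frac{a_n}{a_{n+1}}\to b\qquad\text{and}\qquad T_{1/a_n}(\mu_1\mu_2\cdots\mu_{k_n})\,\delta_{x_n}\to\mu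 .$$ A measure $\mu\in\mathcal P(E)$ is called $T$-decomposable with co-factor $\nu\in\mathcal P(E)$ if $\mu=T(\mu)\,\nu$, and strongly $T$-decomposable with co-factor $\nu$ if moreover $T^n(\mu)\to\delta_0$ as $n\to\infty$. **Theorem.** Let $H\subset\mathcal P(E)$ be $(T_t)$-completely closed. Then: 1. $\tilde K(H,b,(T_t))$ is also $(T_t)$-completely closed. 2. For every $\mu\in\mathcal P(E)$ the following are equivalent: (i) $\mu\in\tilde K(H,b,(T_t))$; (ii) $\mu$ is $T_b$-decomposable with some (not necessarily unique) co-factor in $H$; (iii) $\mu$ is strongly $T_b$-decomposable with some (not necessarily unique) co-factor in $H$. -/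

import Mathlib

open MeasureTheory Filter Topology

namespace OperatorDecomposable

/-- The multiplicative group `(0, ∞)` of positive real numbers. -/
abbrev PosReal : Type := {r : ℝ // 0 < r}

section Convolution

variable {E : Type*} [AddCommGroup E] [MeasurableSpace E] [MeasurableAdd₂ E]

/-- Probability measures on `E` form a commutative monoid: the product is convolution and the
unit is the Dirac measure at `0`. -/
noncomputable instance convMonoid : CommMonoid (ProbabilityMeasure E) where
  mul μ ν := ⟨Measure.conv (μ : Measure E) (ν : Measure E), inferInstance⟩
  one := diracProba (0 : E)
  mul_assoc μ ν ρ :=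
    Subtype.ext (Measure.conv_assoc (μ : Measure E) (ν : Measure E) (ρ : Measure E))
  one_mul μ := Subtype.ext (Measure.dirac_zero_conv (μ : Measure E))
  mul_one μ := Subtype.ext (Measure.conv_dirac_zero (μ : Measure E))
  mul_comm μ ν := Subtype.ext (Measure.conv_comm (μ : Measure E) (ν : Measure E))

theorem coe_mul (μ ν : ProbabilityMeasure E) :
    ((μ * ν : ProbabilityMeasure E) : Measure E) =
      Measure.conv (μ : Measure E) (ν : Measure E) := rfl

theorem one_eq_dirac : (1 : ProbabilityMeasure E) = diracProba (0 : E) := rfl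

end Convolution

section Operators

variable {E : Type*} [AddCommGroup E] [Module ℝ E] [TopologicalSpace E]

/-- `T` is a one-parameter subgroup `(T_t)`, `t > 0`, of invertible continuous linear operators
(a homomorphism, `T_{st} = T_s T_t`), continuous for the strong operator topology, such that
`T_t x → 0` as `t → 0` for every `x`. -/
structure IsContractiveGroup (T : PosReal →* (E ≃L[ℝ] E)) : Prop where
  continuous : ∀ x : E, Continuous fun t : PosReal => T t x
  tendsto_zero : ∀ x : E,
    Tendsto (fun t : PosReal => T t x) (comap (fun t : PosReal => (t : ℝ)) (𝓝 0)) (𝓝 0)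

variable [MeasurableSpace E] [BorelSpace E]

/-- The image `T(μ)` of a probability measure: `T(μ)(B) = μ(T⁻¹(B))`. -/
noncomputable def image (T : E ≃L[ℝ] E) (μ : ProbabilityMeasure E) : ProbabilityMeasure E :=
  μ.map (f := fun x => T x) T.continuous.measurable.aemeasurable

variable [MeasurableAdd₂ E]

/-- `μ` is `T`-decomposable with co-factor `ν`: `μ = T(μ) ν`. -/
def IsDecomposableWith (T : E ≃L[ℝ] E) (μ ν : ProbabilityMeasure E) : Prop :=
  μ = image T μ * ν

/-- `μ` is strongly `T`-decomposable with co-factor `ν`: moreover `Tⁿ(μ) → δ₀`. -/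
def IsStronglyDecomposableWith (T : E ≃L[ℝ] E) (μ ν : ProbabilityMeasure E) : Prop :=
  IsDecomposableWith T μ ν ∧ Tendsto (fun n : ℕ => image (T ^ n) μ) atTop (𝓝 (diracProba 0))

/-- `H` is `(T_t)`-completely closed: a (weakly) closed subsemigroup of the convolution semigroup
of probability measures, containing `T_a(μ) * δ_x` for all `μ ∈ H`, `a > 0`, `x ∈ E`. -/
structure IsCompletelyClosed (T : PosReal →* (E ≃L[ℝ] E)) (H : Set (ProbabilityMeasure E)) :
    Prop where
  isClosed : IsClosed H
  mul_mem : ∀ μ ∈ H, ∀ ν ∈ H, μ * ν ∈ H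
  image_mul_dirac_mem : ∀ μ ∈ H, ∀ (a : PosReal) (x : E), image (T a) μ * diracProba x ∈ H

/-- The class `K̃(H, b, (T_t))`: all weak limits of `T_{1/a_n}(μ_1 ⋯ μ_{k_n}) δ_{x_n}` with
`μ_i ∈ H`, `a_n > 0`, `a_n / a_{n+1} → b`, `1 ≤ k_1 < k_2 < ⋯` and `x_n ∈ E`. The sequence of
measures is indexed from `0`, so that `μ_1 ⋯ μ_k` is the product over `range k`. -/
def KTilde (H : Set (ProbabilityMeasure E)) (b : PosReal) (T : PosReal →* (E ≃L[ℝ] E)) :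
    Set (ProbabilityMeasure E) :=
  {μ | ∃ (m : ℕ → ProbabilityMeasure E) (a : ℕ → PosReal) (k : ℕ → ℕ) (x : ℕ → E),
    (∀ i, m i ∈ H) ∧
    Tendsto (fun n => (a n : ℝ) / (a (n + 1) : ℝ)) atTop (𝓝 (b : ℝ)) ∧
    StrictMono k ∧ (∀ n, 1 ≤ k n) ∧
    Tendsto (fun n => image (T (a n)⁻¹) (∏ i ∈ Finset.range (k n), m i) * diracProba (x n))
      atTop (𝓝 μ)}

end Operators

end OperatorDecomposable

namespace OperatorDecomposable

/-! Everything reduces to: `μ ∈ KTilde H b T` iff `μ = T_b(μ) ν` for some `ν ∈ H`.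

If `μ` is a limit of normed products `f n`, then `f (n + 1)` is `T_{a_n/a_{n+1}}(f n)` convolved
with a `g n ∈ H` built from the new block of factors. The first factor tends to `T_b(μ)` by joint
continuity of `(t, x) ↦ T_t x`, which Banach–Steinhaus supplies. Since convolution factors inherit
tightness (Prokhorov), a subsequence of `g` converges, and its limit is the co-factor.

Conversely, iterating gives `μ = T_b^n(μ) ∏_{i<n} T_b^i(ν)`. As `T_b^n(μ) → δ₀`, the products tend
to `μ`, and they are normed products of elements of `H`.

Strong decomposability is automatic because `b < 1`. The closure properties of `KTilde` are those of
`H`, read through co-factors. -/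

/-- A weakly convergent sequence of probability measures on a Polish space is tight. -/
theorem exists_isCompact_of_tendsto {E : Type*} [TopologicalSpace E] [PolishSpace E]
    [MeasurableSpace E] [BorelSpace E] {f : ℕ → ProbabilityMeasure E} {μ : ProbabilityMeasure E}
    (hf : Tendsto f atTop (𝓝 μ)) {ε : ENNReal} (hε : 0 < ε) :
    ∃ K : Set E, IsCompact K ∧ ∀ n, (f n : Measure E) Kᶜ ≤ ε := by
  let := TopologicalSpace.upgradeIsCompletelyMetrizable E
  have hc : IsCompact (closure (Set.range f)) :=
    hf.isCompact_insert_range.closure_of_subset (Set.subset_insert _ _)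
  obtain ⟨K, hK, h⟩ := isTightMeasureSet_iff_exists_isCompact_measure_compl_le.1
    (isTightMeasureSet_of_isCompact_closure hc) ε hε
  exact ⟨K, hK, fun n => h _ ⟨f n, ⟨n, rfl⟩, rfl⟩⟩

/-! ### Convolution, tightness and limits of factors. -/

section Topology

open scoped Pointwise

variable {E : Type*} [AddCommGroup E] [TopologicalSpace E] [IsTopologicalAddGroup E]
  [PolishSpace E] [MeasurableSpace E] [BorelSpace E]

/-- Convolution of probability measures is jointly continuous for weak convergence. -/
theorem continuous_mul_probabilityMeasure :
    Continuous fun p : ProbabilityMeasure E × ProbabilityMeasure E => p.1 * p.2 :=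
  (ProbabilityMeasure.continuous_map (continuous_add (M := E))).comp
    ProbabilityMeasure.continuous_prod

theorem tendsto_mul_probabilityMeasure {ι : Type*} {l : Filter ι}
    {f g : ι → ProbabilityMeasure E} {μ ν : ProbabilityMeasure E}
    (hf : Tendsto f l (𝓝 μ)) (hg : Tendsto g l (𝓝 ν)) :
    Tendsto (fun i => f i * g i) l (𝓝 (μ * ν)) :=
  (continuous_mul_probabilityMeasure.tendsto (μ, ν)).comp (hf.prodMk_nhds hg)

theorem diracProba_mul_diracProba (x y : E) :
    diracProba x * diracProba y = diracProba (x + y) :=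
  Subtype.ext (Measure.dirac_conv_dirac x y)

/-- The mass which the second factor of a convolution puts outside `L - K`. -/
theorem measure_compl_sub_le (μ ν : ProbabilityMeasure E) (K : Set E) {L : Set E}
    (hL : IsClosed L) :
    (ν : Measure E) (L - K)ᶜ ≤
      (μ : Measure E) Kᶜ + ((μ * ν : ProbabilityMeasure E) : Measure E) Lᶜ := by
  have h1 : (ν : Measure E) (L - K)ᶜ
      = (μ : Measure E).prod (ν : Measure E) (Set.univ ×ˢ (L - K)ᶜ) := by
    simp [Measure.prod_prod]
  have h2 : (μ : Measure E) Kᶜ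
      = (μ : Measure E).prod (ν : Measure E) (Kᶜ ×ˢ Set.univ) := by
    simp [Measure.prod_prod]
  have h3 : ((μ * ν : ProbabilityMeasure E) : Measure E) Lᶜ
      = (μ : Measure E).prod (ν : Measure E) ((fun p : E × E => p.1 + p.2) ⁻¹' Lᶜ) := by
    rw [coe_mul, Measure.conv, Measure.map_apply (by fun_prop) hL.measurableSet.compl]
  rw [h1, h2, h3]
  refine (measure_mono ?_).trans (measure_union_le _ _)
  rintro ⟨x, y⟩ hxy
  by_contra h
  simp only [Set.mem_union, Set.mem_prod, Set.mem_compl_iff, Set.mem_univ, and_true,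
    Set.mem_preimage, not_or, not_not, true_and] at h hxy
  -- If `x ∈ K` and `x + y ∈ L`, then `y = (x + y) - x` lies in `L - K`.
  exact hxy ⟨x + y, h.2, x, h.1, by simp⟩

/-- If `μₙ → μ` and `μₙ * νₙ → ρ`, then some subsequence of `νₙ` converges, and its limit `ν`
satisfies `μ * ν = ρ`. -/
theorem exists_subseq_tendsto_of_tendsto_mul {f g : ℕ → ProbabilityMeasure E}
    {μ ρ : ProbabilityMeasure E} (hf : Tendsto f atTop (𝓝 μ))
    (hfg : Tendsto (fun n => f n * g n) atTop (𝓝 ρ)) :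
    ∃ (ν : ProbabilityMeasure E) (φ : ℕ → ℕ), StrictMono φ ∧
      Tendsto (g ∘ φ) atTop (𝓝 ν) ∧ μ * ν = ρ := by
  have htight : IsTightMeasureSet
      {((ν : ProbabilityMeasure E) : Measure E) | ν ∈ Set.range g} := by
    rw [isTightMeasureSet_iff_exists_isCompact_measure_compl_le]
    intro ε hε
    obtain ⟨K, hK, hK'⟩ := exists_isCompact_of_tendsto hf (ENNReal.half_pos hε.ne')
    obtain ⟨L, hL, hL'⟩ := exists_isCompact_of_tendsto hfg (ENNReal.half_pos hε.ne')
    refine ⟨L - K, by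
      simpa [← Set.image_prod, Set.sub_image_prod] using (hL.prod hK).image continuous_sub, ?_⟩
    rintro _ ⟨_, ⟨n, rfl⟩, rfl⟩
    exact (measure_compl_sub_le (f n) (g n) K hL.isClosed).trans
      ((add_le_add (hK' n) (hL' n)).trans_eq (ENNReal.add_halves ε))
  obtain ⟨ν, -, φ, hφ, hν⟩ := (isCompact_closure_of_isTightMeasureSet htight).tendsto_subseq
    (x := g) fun n => subset_closure ⟨n, rfl⟩
  exact ⟨ν, φ, hφ, hν, tendsto_nhds_unique
    (tendsto_mul_probabilityMeasure (hf.comp hφ.tendsto_atTop) hν) (hfg.comp hφ.tendsto_atTop)⟩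

/-- If `μₙ → δ₀` and `μₙ * νₙ → ρ`, then `νₙ → ρ`. -/
theorem tendsto_of_tendsto_mul_of_tendsto_one {f g : ℕ → ProbabilityMeasure E}
    {ρ : ProbabilityMeasure E} (hf : Tendsto f atTop (𝓝 1))
    (hfg : Tendsto (fun n => f n * g n) atTop (𝓝 ρ)) : Tendsto g atTop (𝓝 ρ) := by
  refine tendsto_of_subseq_tendsto fun ns hns => ?_
  obtain ⟨ν, φ, -, hν, h⟩ := exists_subseq_tendsto_of_tendsto_mul (hf.comp hns)
    (g := g ∘ ns) (hfg.comp hns)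
  rw [one_mul] at h
  exact ⟨φ, h ▸ hν⟩

end Topology

/-! ### Equicontinuity and joint continuity of the group action. -/

section Equicontinuity

variable {E : Type*} [AddCommGroup E] [Module ℝ E] [TopologicalSpace E]
  [IsTopologicalAddGroup E] [ContinuousSMul ℝ E]

/-- Banach–Steinhaus without local convexity: a pointwise convergent sequence of continuous linear
operators on a Baire topological vector space is equicontinuous at `0`. -/
theorem exists_nhds_zero_forall_mem [BaireSpace E] (A : ℕ → E →L[ℝ] E) (B : E → E)
    (hA : ∀ x, Tendsto (fun n => A n x) atTop (𝓝 (B x))) {U : Set E} (hU : U ∈ 𝓝 (0 : E)) :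
    ∃ V ∈ 𝓝 (0 : E), ∀ n, ∀ x ∈ V, A n x ∈ U := by
  obtain ⟨W₀, hW₀, hWU⟩ := exists_nhds_half_neg hU
  obtain ⟨W, hW, hWc, hWW₀⟩ := exists_mem_nhds_isClosed_subset hW₀
  -- These closed sets cover `E`: each orbit with its limit is compact, hence absorbed by `W`. By
  -- Baire, one of them has an interior point.
  set F : ℕ → Set E := fun m => {x | ∀ n, ((m : ℝ) + 1)⁻¹ • A n x ∈ W} with hF
  have hFc : ∀ m, IsClosed (F m) := fun m => by
    simp only [hF, Set.ofPred_forall]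
    exact isClosed_iInter fun n =>
      hWc.preimage (((A n).continuous).const_smul _)
  have hcov : ⋃ m, F m = Set.univ := by
    refine Set.eq_univ_of_forall fun x => ?_
    have hs : Tendsto (fun m : ℕ => ((m : ℝ) + 1)⁻¹) atTop (𝓝 0) := by
      simpa [one_div] using tendsto_one_div_add_atTop_nhds_zero_nat (𝕜 := ℝ)
    have hcpt : IsCompact (insert (B x) (Set.range fun n => A n x)) := (hA x).isCompact_insert_range
    have hev : ∀ᶠ r : ℝ in 𝓝 0, ∀ y ∈ insert (B x) (Set.range fun n => A n x), r • y ∈ W := by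
      refine hcpt.eventually_forall_of_forall_eventually fun y _ => ?_
      have hc : Tendsto (fun p : ℝ × E => p.1 • p.2) (𝓝 ((0 : ℝ), y)) (𝓝 0) := by
        simpa using (continuous_smul (M := ℝ) (X := E)).tendsto ((0 : ℝ), y)
      exact hc hW
    obtain ⟨m, hm⟩ := (hs.eventually hev).exists
    exact Set.mem_iUnion.2 ⟨m, fun n => hm _ (Or.inr ⟨n, rfl⟩)⟩
  obtain ⟨m, x₀, hx₀⟩ := nonempty_interior_of_iUnion_of_closed hFc hcov
  have hnear : ∀ᶠ x : E in 𝓝 0, x₀ + ((m : ℝ) + 1) • x ∈ F m := by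
    have hc : Tendsto (fun x : E => x₀ + ((m : ℝ) + 1) • x) (𝓝 0) (𝓝 x₀) := by
      have : Continuous fun x : E => x₀ + ((m : ℝ) + 1) • x := by fun_prop
      simpa using this.tendsto 0
    exact hc.eventually (mem_interior_iff_mem_nhds.1 hx₀)
  refine ⟨_, hnear, fun n x hx => ?_⟩
  have hm : ((m : ℝ) + 1) ≠ 0 := by positivity
  -- Both `x₀ + (m + 1) • x` and `x₀` lie in `F m`; subtracting their scaled images leaves exactly
  -- `A n x`.
  have h := hWU _ (hWW₀ (hx n)) _ (hWW₀ (interior_subset hx₀ n))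
  rwa [map_add, map_smul, smul_add, smul_smul, inv_mul_cancel₀ hm, one_smul,
    add_sub_cancel_left] at h

/-- Along a convergent sequence, split `T_{t_n} x_n = T_{t_n}(x_n - x) + T_{t_n} x`: equicontinuity
kills the first term, strong continuity handles the second. -/
theorem IsContractiveGroup.continuous_uncurry [PolishSpace E]
    {T : PosReal →* (E ≃L[ℝ] E)} (hT : IsContractiveGroup T) :
    Continuous fun p : PosReal × E => T p.1 p.2 := by
  refine continuous_iff_seqContinuous.2 fun p q hp => ?_
  have h1 : Tendsto (fun n => (p n).1) atTop (𝓝 q.1) := (continuous_fst.tendsto q).comp hp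
  have h2 : Tendsto (fun n => (p n).2 - q.2) atTop (𝓝 0) := by
    simpa using ((continuous_snd.tendsto q).comp hp).sub_const q.2
  have hpt : ∀ x, Tendsto (fun n => T (p n).1 x) atTop (𝓝 (T q.1 x)) := fun x =>
    ((hT.continuous x).tendsto q.1).comp h1
  have h3 : Tendsto (fun n => T (p n).1 ((p n).2 - q.2)) atTop (𝓝 0) := by
    intro U hU
    obtain ⟨V, hV, h⟩ := exists_nhds_zero_forall_mem
      (fun n => ((T (p n).1 : E ≃L[ℝ] E) : E →L[ℝ] E)) (fun x => T q.1 x) hpt hU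
    exact mem_map.2 (mem_of_superset (mem_map.1 (h2 hV)) fun n hn => h n _ hn)
  simpa [Function.comp_def] using h3.add (hpt q.2)

end Equicontinuity

/-! ### Images of measures and iterated decompositions. -/

section Image

variable {E : Type*} [AddCommGroup E] [Module ℝ E] [TopologicalSpace E]
  [MeasurableSpace E] [BorelSpace E]

theorem coe_image (A : E ≃L[ℝ] E) (μ : ProbabilityMeasure E) :
    (image A μ : Measure E) = (μ : Measure E).map A := rfl

theorem image_one (μ : ProbabilityMeasure E) : image (1 : E ≃L[ℝ] E) μ = μ :=
  Subtype.ext Measure.map_id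

theorem image_image (A B : E ≃L[ℝ] E) (μ : ProbabilityMeasure E) :
    image A (image B μ) = image (A * B) μ :=
  Subtype.ext (Measure.map_map A.continuous.measurable B.continuous.measurable)

theorem image_dirac (A : E ≃L[ℝ] E) (x : E) : image A (diracProba x) = diracProba (A x) :=
  Subtype.ext (Measure.map_dirac' A.continuous.measurable x)

theorem continuous_image (A : E ≃L[ℝ] E) : Continuous (image A) :=
  ProbabilityMeasure.continuous_map A.continuous

/-- The image of a fixed measure under operators tending pointwise to `0` tends to `δ₀`. -/
theorem tendsto_image_of_tendsto_zero (A : ℕ → E ≃L[ℝ] E)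
    (hA : ∀ x, Tendsto (fun n => A n x) atTop (𝓝 0)) (μ : ProbabilityMeasure E) :
    Tendsto (fun n => image (A n) μ) atTop (𝓝 (diracProba 0)) := by
  rw [ProbabilityMeasure.tendsto_iff_forall_integral_tendsto]
  intro f
  have h0 : ∫ x, f x ∂(diracProba (0 : E) : Measure E) = ∫ _, f 0 ∂(μ : Measure E) := by
    have : (diracProba (0 : E) : Measure E) = Measure.dirac 0 := rfl
    rw [this, integral_dirac' _ _ f.continuous.stronglyMeasurable]
    simp
  have hn : ∀ n, ∫ x, f x ∂(image (A n) μ : Measure E)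
      = ∫ x, f (A n x) ∂(μ : Measure E) := fun n => by
    rw [coe_image, integral_map (A n).continuous.measurable.aemeasurable
      f.continuous.aestronglyMeasurable]
  simp_rw [hn, h0]
  refine tendsto_integral_of_dominated_convergence (fun _ => ‖f‖) (fun n => ?_)
    (integrable_const _) (fun n => ae_of_all _ fun x => f.norm_coe_le_norm _)
    (ae_of_all _ fun x => (f.continuous.tendsto 0).comp (hA x))
  exact (f.continuous.comp (A n).continuous).aestronglyMeasurable

variable [MeasurableAdd₂ E]

theorem image_mul (A : E ≃L[ℝ] E) (μ ν : ProbabilityMeasure E) :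
    image A (μ * ν) = image A μ * image A ν :=
  Subtype.ext (Measure.map_conv_continuousLinearMap (A : E →L[ℝ] E))

/-- The image of measures under an operator, as an endomorphism of the convolution monoid. -/
noncomputable def imageHom (A : E ≃L[ℝ] E) : ProbabilityMeasure E →* ProbabilityMeasure E where
  toFun := image A
  map_one' := by rw [one_eq_dirac, image_dirac, map_zero]
  map_mul' := image_mul A

theorem image_prod {ι : Type*} (A : E ≃L[ℝ] E) (s : Finset ι) (f : ι → ProbabilityMeasure E) :
    image A (∏ i ∈ s, f i) = ∏ i ∈ s, image A (f i) :=
  map_prod (imageHom A) f s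

theorem IsDecomposableWith.mul {A : E ≃L[ℝ] E} {μ ν μ' ν' : ProbabilityMeasure E}
    (h : IsDecomposableWith A μ ν) (h' : IsDecomposableWith A μ' ν') :
    IsDecomposableWith A (μ * μ') (ν * ν') := by
  unfold IsDecomposableWith at *
  rw [image_mul, mul_mul_mul_comm, ← h, ← h']

theorem IsDecomposableWith.eq_image_pow_mul {A : E ≃L[ℝ] E} {μ ν : ProbabilityMeasure E}
    (h : IsDecomposableWith A μ ν) (n : ℕ) :
    μ = image (A ^ n) μ * ∏ i ∈ Finset.range n, image (A ^ i) ν := by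
  induction n with
  | zero => simp [image_one]
  | succ n ih =>
    have h' : image (A ^ n) μ = image (A ^ (n + 1)) μ * image (A ^ n) ν := by
      conv_lhs => rw [h]
      rw [image_mul, image_image, ← pow_succ]
    rw [Finset.prod_range_succ, mul_comm (∏ i ∈ Finset.range n, _), ← mul_assoc, ← h', ← ih]

end Image

theorem IsContractiveGroup.tendsto_pow {E : Type*} [AddCommGroup E] [Module ℝ E]
    [TopologicalSpace E] {T : PosReal →* (E ≃L[ℝ] E)} (hT : IsContractiveGroup T)
    {b : PosReal} (hb : (b : ℝ) < 1) (x : E) :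
    Tendsto (fun n : ℕ => (T b ^ n) x) atTop (𝓝 0) := by
  have h : Tendsto (fun n : ℕ => b ^ n) atTop (comap (fun t : PosReal => (t : ℝ)) (𝓝 0)) := by
    rw [tendsto_comap_iff]
    exact tendsto_pow_atTop_nhds_zero_of_lt_one b.2.le hb
  simpa only [Function.comp_def, map_pow] using (hT.tendsto_zero x).comp h

theorem IsContractiveGroup.tendsto_image_pow {E : Type*} [AddCommGroup E]
    [Module ℝ E] [TopologicalSpace E] [MeasurableSpace E] [BorelSpace E]
    {T : PosReal →* (E ≃L[ℝ] E)} (hT : IsContractiveGroup T) {b : PosReal} (hb : (b : ℝ) < 1)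
    (μ : ProbabilityMeasure E) :
    Tendsto (fun n : ℕ => image (T b ^ n) μ) atTop (𝓝 (diracProba 0)) :=
  tendsto_image_of_tendsto_zero _ (hT.tendsto_pow hb) μ

/-! ### The class `KTilde` and its co-factor description. -/

section Group

variable {E : Type*} [AddCommGroup E] [Module ℝ E] [TopologicalSpace E]
  [IsTopologicalAddGroup E] [PolishSpace E] [MeasurableSpace E] [BorelSpace E]
  {T : PosReal →* (E ≃L[ℝ] E)} {H : Set (ProbabilityMeasure E)} {b : PosReal}

theorem IsDecomposableWith.image_mul_dirac {μ ν : ProbabilityMeasure E}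
    (h : IsDecomposableWith (T b) μ ν) (a : PosReal) (x : E) :
    IsDecomposableWith (T b) (image (T a) μ * diracProba x)
      (image (T a) ν * diracProba (x - T b x)) := by
  have hx : diracProba x = diracProba (T b x) * diracProba (x - T b x) := by
    rw [diracProba_mul_diracProba, add_sub_cancel]
  have hμ : image (T a) μ = image (T b) (image (T a) μ) * image (T a) ν := by
    conv_lhs => rw [h]
    rw [image_mul, image_image, image_image, ← map_mul, ← map_mul, mul_comm a b]
  unfold IsDecomposableWith
  rw [image_mul, image_dirac, mul_mul_mul_comm, ← hμ, ← hx]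

theorem IsCompletelyClosed.image_mem (hH : IsCompletelyClosed T H) {μ : ProbabilityMeasure E}
    (hμ : μ ∈ H) (a : PosReal) : image (T a) μ ∈ H := by
  simpa [← one_eq_dirac] using hH.image_mul_dirac_mem μ hμ a 0

/-- Powers `b⁻ⁿ⁻¹` as norming constants exhibit a decomposable measure as an element of `K̃`. -/
theorem IsCompletelyClosed.mem_KTilde_of_isDecomposableWith (hT : IsContractiveGroup T)
    (hb : (b : ℝ) < 1) (hH : IsCompletelyClosed T H) {μ ν : ProbabilityMeasure E} (hν : ν ∈ H)
    (h : IsDecomposableWith (T b) μ ν) : μ ∈ KTilde H b T := by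
  -- With these choices the ratios equal `b` exactly, and norming turns the `i`-th factor into
  -- `T_b^(n - i)(ν)`; reversing the product gives the iterated co-factor.
  refine ⟨fun i => image (T (b ^ (i + 1))⁻¹) ν, fun n => (b ^ (n + 1))⁻¹, fun n => n + 1,
    fun _ => 0, fun i => hH.image_mem hν _, ?_, fun _ _ h => by simpa using h,
    fun n => by simp, ?_⟩
  · have hb0 : (b : ℝ) ≠ 0 := b.2.ne'
    refine tendsto_const_nhds.congr fun n => ?_
    change (b : ℝ) = ((b : ℝ) ^ (n + 1))⁻¹ / ((b : ℝ) ^ (n + 1 + 1))⁻¹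
    field_simp
    ring
  · have hprod : ∀ n : ℕ, image (T ((b ^ (n + 1))⁻¹)⁻¹)
        (∏ i ∈ Finset.range (n + 1), image (T (b ^ (i + 1))⁻¹) ν) * diracProba 0
        = ∏ i ∈ Finset.range (n + 1), image (T b ^ i) ν := fun n => by
      rw [← one_eq_dirac, mul_one, image_prod, ← Finset.prod_range_reflect]
      refine Finset.prod_congr rfl fun i hi => ?_
      have hi' : i < n + 1 := Finset.mem_range.1 hi
      rw [image_image, ← map_mul, ← map_pow]
      congr 2
      rw [inv_inv, mul_inv_eq_iff_eq_mul, ← pow_add]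
      congr 1
      omega
    simp_rw [hprod]
    refine (tendsto_of_tendsto_mul_of_tendsto_one (hT.tendsto_image_pow hb μ)
      (g := fun n => ∏ i ∈ Finset.range n, image (T b ^ i) ν) ?_).comp (tendsto_add_atTop_nat 1)
    exact tendsto_const_nhds.congr fun n => h.eq_image_pow_mul n

/-- Limits of decomposable measures are decomposable, with a co-factor in the same closed set. -/
theorem exists_isDecomposableWith_of_tendsto (hH : IsClosed H) (A : E ≃L[ℝ] E)
    {f g : ℕ → ProbabilityMeasure E} {μ : ProbabilityMeasure E} (hg : ∀ n, g n ∈ H)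
    (hfg : ∀ n, IsDecomposableWith A (f n) (g n)) (hf : Tendsto f atTop (𝓝 μ)) :
    ∃ ν ∈ H, IsDecomposableWith A μ ν := by
  obtain ⟨ν, φ, -, hν, h⟩ := exists_subseq_tendsto_of_tendsto_mul
    (((continuous_image A).tendsto μ).comp hf) (g := g) (ρ := μ) (hf.congr hfg)
  exact ⟨ν, hH.mem_of_tendsto hν (Eventually.of_forall fun n => hg _), h.symm⟩

theorem IsCompletelyClosed.prod_Ico_mem (hH : IsCompletelyClosed T H)
    {m : ℕ → ProbabilityMeasure E} (hm : ∀ i, m i ∈ H) {k l : ℕ} (hkl : k < l) :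
    ∏ i ∈ Finset.Ico k l, m i ∈ H := by
  induction l, hkl using Nat.le_induction with
  | base => simpa using hm k
  | succ l hl ih =>
    rw [Finset.prod_Ico_succ_top (by omega)]
    exact hH.mul_mem _ ih _ (hm l)

variable [ContinuousSMul ℝ E]

theorem IsContractiveGroup.tendsto_image (hT : IsContractiveGroup T) {c : ℕ → PosReal}
    {f : ℕ → ProbabilityMeasure E} {μ : ProbabilityMeasure E} (hc : Tendsto c atTop (𝓝 b))
    (hf : Tendsto f atTop (𝓝 μ)) :
    Tendsto (fun n => image (T (c n)) (f n)) atTop (𝓝 (image (T b) μ)) := by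
  -- Writing the image as a pushforward of `δ_t ⊗ ν` under one jointly continuous map lets operator
  -- and measure vary together.
  have key : ∀ (t : PosReal) (ν : ProbabilityMeasure E), image (T t) ν
      = ((diracProba t).prod ν).map (f := fun p : PosReal × E => T p.1 p.2)
        hT.continuous_uncurry.measurable.aemeasurable := fun t ν => by
    refine Subtype.ext ?_
    change (ν : Measure E).map (T t)
      = ((Measure.dirac t).prod (ν : Measure E)).map (fun p : PosReal × E => T p.1 p.2)
    rw [Measure.dirac_prod, Measure.map_map hT.continuous_uncurry.measurable (by fun_prop)]
    rfl
  simp_rw [key]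
  exact ((ProbabilityMeasure.continuous_map hT.continuous_uncurry).comp
    ProbabilityMeasure.continuous_prod).tendsto (diracProba b, μ) |>.comp
    (((continuous_diracProba.tendsto b).comp hc).prodMk_nhds hf)

theorem IsCompletelyClosed.exists_isDecomposableWith_of_mem_KTilde (hT : IsContractiveGroup T)
    (hH : IsCompletelyClosed T H) {μ : ProbabilityMeasure E} (hμ : μ ∈ KTilde H b T) :
    ∃ ν ∈ H, IsDecomposableWith (T b) μ ν := by
  obtain ⟨m, a, k, x, hm, ha, hk, -, hlim⟩ := hμ
  set f : ℕ → ProbabilityMeasure E := fun n =>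
    image (T (a n)⁻¹) (∏ i ∈ Finset.range (k n), m i) * diracProba (x n) with hf
  have hc : Tendsto (fun n => a n / a (n + 1)) atTop (𝓝 b) := tendsto_subtype_rng.2 ha
  -- The block is nonempty because `k` is strictly increasing, so it lies in `H` even if `δ₀` does
  -- not; the shift corrects the moved centring `x n`.
  set g : ℕ → ProbabilityMeasure E := fun n =>
    image (T (a (n + 1))⁻¹) (∏ i ∈ Finset.Ico (k n) (k (n + 1)), m i) *
      diracProba (x (n + 1) - T (a n / a (n + 1)) (x n)) with hg
  have hfg : ∀ n, f (n + 1) = image (T (a n / a (n + 1))) (f n) * g n := fun n => by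
    simp only [hf, hg]
    rw [image_mul, image_dirac, image_image, ← map_mul, mul_mul_mul_comm,
      diracProba_mul_diracProba, add_sub_cancel, div_mul_eq_mul_div, mul_inv_cancel, one_div,
      ← image_mul, Finset.prod_range_mul_prod_Ico _ (hk n.lt_succ_self).le]
  have hgH : ∀ n, g n ∈ H := fun n =>
    hH.image_mul_dirac_mem _ (hH.prod_Ico_mem hm (hk n.lt_succ_self)) _ _
  obtain ⟨ν, φ, -, hν, h⟩ := exists_subseq_tendsto_of_tendsto_mul (hT.tendsto_image hc hlim)
    (g := g) (ρ := μ) ((hlim.comp (tendsto_add_atTop_nat 1)).congr hfg)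
  exact ⟨ν, hH.isClosed.mem_of_tendsto hν (Eventually.of_forall fun n => hgH _), h.symm⟩

theorem IsCompletelyClosed.mem_KTilde_iff (hT : IsContractiveGroup T) (hb : (b : ℝ) < 1)
    (hH : IsCompletelyClosed T H) {μ : ProbabilityMeasure E} :
    μ ∈ KTilde H b T ↔ ∃ ν ∈ H, IsDecomposableWith (T b) μ ν :=
  ⟨hH.exists_isDecomposableWith_of_mem_KTilde hT,
    fun ⟨_, hν, h⟩ => hH.mem_KTilde_of_isDecomposableWith hT hb hν h⟩

theorem IsCompletelyClosed.kTilde (hT : IsContractiveGroup T) (hb : (b : ℝ) < 1)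
    (hH : IsCompletelyClosed T H) : IsCompletelyClosed T (KTilde H b T) where
  isClosed := by
    refine IsSeqClosed.isClosed fun f μ hf hlim => ?_
    choose g hg hfg using fun n => (hH.mem_KTilde_iff hT hb).1 (hf n)
    exact (hH.mem_KTilde_iff hT hb).2
      (exists_isDecomposableWith_of_tendsto hH.isClosed (T b) hg hfg hlim)
  mul_mem μ hμ μ' hμ' := by
    rw [hH.mem_KTilde_iff hT hb] at *
    obtain ⟨ν, hν, h⟩ := hμ
    obtain ⟨ν', hν', h'⟩ := hμ'
    exact ⟨ν * ν', hH.mul_mem ν hν ν' hν', h.mul h'⟩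
  image_mul_dirac_mem μ hμ a x := by
    rw [hH.mem_KTilde_iff hT hb] at *
    obtain ⟨ν, hν, h⟩ := hμ
    exact ⟨_, hH.image_mul_dirac_mem ν hν a _, h.image_mul_dirac a x⟩

end Group

end OperatorDecomposable

theorem mainTheorem5 {E : Type*} [AddCommGroup E] [Module ℝ E] [TopologicalSpace E]
    [IsTopologicalAddGroup E] [ContinuousSMul ℝ E] [PolishSpace E]
    [MeasurableSpace E] [BorelSpace E]
    (T : OperatorDecomposable.PosReal →* (E ≃L[ℝ] E))
    (hT : OperatorDecomposable.IsContractiveGroup T)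
    (b : OperatorDecomposable.PosReal) (hb : (b : ℝ) < 1)
    (H : Set (ProbabilityMeasure E))
    (hH : OperatorDecomposable.IsCompletelyClosed T H) :
    OperatorDecomposable.IsCompletelyClosed T (OperatorDecomposable.KTilde H b T) ∧
    ∀ μ : ProbabilityMeasure E,
      (μ ∈ OperatorDecomposable.KTilde H b T ↔
        ∃ ν ∈ H, OperatorDecomposable.IsDecomposableWith (T b) μ ν) ∧
      (μ ∈ OperatorDecomposable.KTilde H b T ↔
        ∃ ν ∈ H, OperatorDecomposable.IsStronglyDecomposableWith (T b) μ ν) :=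
  ⟨hH.kTilde hT hb, fun _ => ⟨hH.mem_KTilde_iff hT hb, (hH.mem_KTilde_iff hT hb).trans
    ⟨fun ⟨ν, hν, h⟩ => ⟨ν, hν, h, hT.tendsto_image_pow hb _⟩,
      fun ⟨ν, hν, h⟩ => ⟨ν, hν, h.1⟩⟩⟩⟩
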